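/- **Setting.** Let $D,d\ge 1$, let $\Lambda_1,\dots,\Lambda_D$ be real diagonal $L\times L$ matrices, $P:\mathbb R^L\to\mathbb R^K$ linear, and $M:\mathbb R^K\to\mathbb R^L$ Lipschitz. Fix reference nodes $0=\tau_0<\tau_1<\dots<\tau_N=1$; for a time step $[t^n,t^n+\Delta t]$ put $t^m=t^n+\tau_m\Delta t$ and $\Delta t^m=t^m-t^0$. Let $\Omega_h$ be a conforming simplicial mesh in $\mathbb R^D$ with cells $\mathcal K$ of diameter $d(\mathcal K)$, $h=\max_{\mathcal K}d(\mathcal K)$; let $(\varphi_\sigma)_{\sigma\in D_h}$ be the Bernstein basis of the continuous piecewise polynomials of degree $d$, $V_h$ the space of $f=\sum_\sigma f_\sigma\varphi_\sigma$ (vector valued), and $|\mathcal C_\sigma|=\sum_{\mathcal K\ni\sigma}\int_{\mathcal K}\varphi_\sigma$. *Residuals.* Let $\phi^{\mathcal K}_{ad,\sigma}:V_h\to\mathbb R^L$ be any (possibly nonlinear) nodal residuals with $\sum_{\sigma\in\mathcal K}\phi^{\mathcal K}_{ad,\sigma}(f)=\int_{\mathcal K}\sum_e\Lambda_e\partial_{x_e}f\,dx$.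 For $\varepsilon>0$ let $\phi^{\mathcal K}_{s,\sigma}(f)=-\frac1\varepsilon\int_{\mathcal K}\varphi_\sigma\,(M(Pf)-f)\,dx$ be the Galerkin source residual, and $\phi^{\mathcal K}_\sigma=\phi^{\mathcal K}_{ad,\sigma}+\phi^{\mathcal K}_{s,\sigma}$. *Operators.* For $\mathbf f=(f^0,\dots,f^N)\in V_h^{N+1}$, $u^m=Pf^m$ and $m=1,\dots,N$, and with $\mathcal I_N$ the interpolation polynomial in time at the nodes $t^0,\dots,t^N$, let $$\mathcal L^{1,m}_\sigma(\mathbf f)=f^m_\sigma-\tfrac{\varepsilon}{\varepsilon+\Delta t^m}f^0_\sigma+\tfrac{\varepsilon\Delta t^m}{|\mathcal C_\sigma|(\varepsilon+\Delta t^m)}\sum_{\mathcal K\ni\sigma}\phi^{\mathcal K}_{ad,\sigma}(f^0)-\tfrac{\Delta t^m}{\varepsilon+\Delta t^m}M(Pf^m_\sigma),$$ $$\mathcal L^{2,m}_\sigma(\mathbf f)=\tfrac{\varepsilon}{|\mathcal C_\sigma|(\varepsilon+\Delta t^m)}\sum_{\mathcal K\ni\sigma}\Big[\int_{\mathcal K}\varphi_\sigma(f^m-f^0)\,dx+\int_{t^0}^{t^m}\mathcal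 I_N(\phi^{\mathcal K}_\sigma(f^0),\dots,\phi^{\mathcal K}_\sigma(f^N),s)\,ds\Big],$$ $$\mathcal L^{1,m}_{u,\sigma}=u^m_\sigma-u^0_\sigma+\tfrac{\Delta t^m}{|\mathcal C_\sigma|}\sum_{\mathcal K\ni\sigma}P\phi^{\mathcal K}_{ad,\sigma}(f^0),$$ $$\mathcal L^{2,m}_{u,\sigma}=\tfrac1{|\mathcal C_\sigma|}\sum_{\mathcal K\ni\sigma}\Big[\int_{\mathcal K}\varphi_\sigma(u^m-u^0)\,dx+\int_{t^0}^{t^m}\mathcal I_N(P\phi^{\mathcal K}_{ad,\sigma}(f^0),\dots,P\phi^{\mathcal K}_{ad,\sigma}(f^N),s)\,ds\Big].$$ *Norms.* For a field $v$ with coefficients $v_\sigma$ and point values $v(x)$ let $\|v\|^2=\sum_\sigma|\mathcal C_\sigma||v_\sigma|^2$, and $|||\mathbf v|||^2=\sum_{m=1}^N\|v^m\|^2$ (likewise for operator values), and $$|v|_{1,x}^2=\sum_\sigma|\mathcal C_\sigma|\Big(\max_{\mathcal K\ni\sigma}\max_{x\in\mathcal K}\tfrac{|v_\sigma-v(x)|}{d(\mathcal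 K)}\Big)^2,\qquad |\mathbf v|_{1,t}^2=\sum_\sigma|\mathcal C_\sigma|\Big(\max_{1\le m\le N}\tfrac{|v^m_\sigma-v^{m-1}_\sigma|}{\Delta t^m}\Big)^2 .$$ Say that $\mathbf v$ satisfies (S) if $|v^m|_{1,x}\le C_1\|v^m\|$ for $m=0,\dots,N$ and $|\mathbf v|_{1,t}\le C_2|||\mathbf v|||$. **Proposition.** For all constants $C_1,C_2,C_3,\kappa,T_{\max}$ there is $\alpha_2>0$, depending only on these and on $D,d,N,(\tau_m),\Lambda,P,M$ (so not on the mesh, $h$, $\Delta t$, $\varepsilon$, the residuals, or $\mathbf f,\mathbf g$), such that for every mesh, every $\phi_{ad}$, every $\varepsilon>0$, $0<\Delta t\le T_{\max}$, $t^n$, every $\Delta>0$ with $h\le\kappa\Delta$ and $\Delta t\le\kappa\Delta$, and all $\mathbf f,\mathbf g\in V_h^{N+1}$ the following hold. 1. If $P\mathbf f-P\mathbf g$ satisfies (S) and, for $r=0,\dots,N$, $$\sum_\sigma\tfrac1{|\mathcal C_\sigma|}\Big|\sum_{\mathcal K\ni\sigma}\big(P\phi^{\mathcal K}_{ad,\sigma}(f^r)-P\phi^{\mathcal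 K}_{ad,\sigma}(g^r)\big)\Big|^2\le C_3\|Pf^r-Pg^r\|^2,$$ then $$|||(\mathcal L^1_u(\mathbf f)-\mathcal L^1_u(\mathbf g))-(\mathcal L^2_u(\mathbf f)-\mathcal L^2_u(\mathbf g))|||\le\alpha_2\,\Delta\,|||P\mathbf f-P\mathbf g|||.$$ 2. If $\mathbf f-\mathbf g$ and $M(P\mathbf f)-M(P\mathbf g)$ (coefficients $M(Pf^m_\sigma)-M(Pg^m_\sigma)$, point values $M(Pf^m(x))-M(Pg^m(x))$) satisfy (S) and, for $r=0,\dots,N$, $$\sum_\sigma\tfrac1{|\mathcal C_\sigma|}\Big|\sum_{\mathcal K\ni\sigma}\big(\phi^{\mathcal K}_{ad,\sigma}(f^r)-\phi^{\mathcal K}_{ad,\sigma}(g^r)\big)\Big|^2\le C_3\|f^r-g^r\|^2,$$ then $$|||(\mathcal L^1(\mathbf f)-\mathcal L^1(\mathbf g))-(\mathcal L^2(\mathbf f)-\mathcal L^2(\mathbf g))|||\le\alpha_2\,\Delta\,|||\mathbf f-\mathbf g|||.$$ -/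

import Mathlib

open scoped NNReal
open MeasureTheory

noncomputable section

namespace KineticRD

/-- `ℝⁿ` with the Euclidean norm. -/
abbrev Eu (n : ℕ) : Type := EuclideanSpace ℝ (Fin n)

/-! ### Meshes and Bernstein finite elements -/

/-- A conforming simplicial mesh in `ℝᴰ`: finitely many nondegenerate closed simplices, distinct
ones having distinct vertex sets, any two of which meet exactly in the common face spanned by their
common vertices. The polygonal domain is the union of the simplices. -/
structure Mesh (D : ℕ) where
  /-- number of cells -/
  n : ℕ
  /-- the vertices of each cell -/
  simplex : Fin n → AffineBasis (Fin (D + 1)) ℝ (Eu D)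
  vertices_injective : Function.Injective fun k => Set.range (simplex k)
  conforming : ∀ k l : Fin n,
    convexHull ℝ (Set.range (simplex k)) ∩ convexHull ℝ (Set.range (simplex l)) =
      convexHull ℝ (Set.range (simplex k) ∩ Set.range (simplex l))

namespace Mesh

variable {D : ℕ} (T : Mesh D)

/-- The closed cell with index `k`. -/
def cell (k : Fin T.n) : Set (Eu D) := convexHull ℝ (Set.range (T.simplex k))

/-- The mesh size: the largest cell diameter. -/
def h : ℝ := ⨆ k : Fin T.n, Metric.diam (T.cell k)

open Classical in
/-- The Bernstein degrees of freedom of degree `d` of the cell `k`: multi-indices of total degree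
`d` on the vertices of the cell. -/
def localDofs (d : ℕ) (k : Fin T.n) : Finset (Eu D →₀ ℕ) :=
  (Finset.univ.image (T.simplex k)).finsuppAntidiag d

open Classical in
/-- The set of all degrees of freedom; cells share those supported on common vertices. -/
def dofs (d : ℕ) : Finset (Eu D →₀ ℕ) := Finset.univ.biUnion (T.localDofs d)

open Classical in
/-- The cells to which a degree of freedom belongs. -/
def cellsOf (d : ℕ) (σ : T.dofs d) : Finset (Fin T.n) :=
  Finset.univ.filter fun k => (σ : Eu D →₀ ℕ) ∈ T.localDofs d k

open Classical in
/-- The restriction to the cell `k` of the Bernstein basis function of `σ`, namely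
`d! / ∏ σ_v! * ∏ λ_v ^ σ_v` with the barycentric coordinates `λ_v` of the cell if `σ` belongs to the
cell, and `0` otherwise (a polynomial in `x`, here defined on all of `ℝᴰ`). -/
def shape (d : ℕ) (k : Fin T.n) (σ : T.dofs d) (x : Eu D) : ℝ :=
  if (σ : Eu D →₀ ℕ) ∈ T.localDofs d k then
    (Finsupp.multinomial (σ : Eu D →₀ ℕ) : ℝ) *
      ∏ i : Fin (D + 1), (T.simplex k).coord i x ^ (σ : Eu D →₀ ℕ) (T.simplex k i)
  else 0

/-- `|C_σ| = ∑_{K ∋ σ} ∫_K φ_σ`. -/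
def mass (d : ℕ) (σ : T.dofs d) : ℝ :=
  ∑ k ∈ T.cellsOf d σ, ∫ x in T.cell k, T.shape d k σ x

/-- The space `V_h` of continuous, piecewise polynomial functions of degree `d` with values in `W`,
represented by the coefficients in the Bernstein basis. -/
abbrev FE (d : ℕ) (W : Type) : Type := T.dofs d → W

section Fields

variable {W : Type} [NormedAddCommGroup W] [NormedSpace ℝ W] {d : ℕ}

/-- The polynomial that represents the finite element function `f` on the cell `k`. -/
def eval (f : T.FE d W) (k : Fin T.n) (x : Eu D) : W :=
  ∑ σ, T.shape d k σ x • f σ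

/-- `‖a‖² = ∑_σ |C_σ| |a_σ|²`. -/
def norm (a : T.FE d W) : ℝ := √(∑ σ, T.mass d σ * ‖a σ‖ ^ 2)

/-- `|||b|||² = ∑_{m=1}^N ‖b^m‖²`; the index `m : Fin N` stands for the subtimestep `m + 1`. -/
def stepNorm {N : ℕ} (b : Fin N → T.FE d W) : ℝ := √(∑ m, T.norm (b m) ^ 2)

/-- `|||a||| = |||(a⁰, …, aᴺ)|||`, with `|||a|||² = ∑_{m=1}^N ‖a^m‖²`. -/
def tripleNorm {N : ℕ} (a : Fin (N + 1) → T.FE d W) : ℝ := T.stepNorm fun m : Fin N => a m.succ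

/-- The spatial seminorm
`|v|²_{1,x} = ∑_σ |C_σ| (max_{K ∋ σ} max_{x ∈ K} |v_σ - v(x)| / diam K)²` of a field with
coefficients `a σ = v_σ` and with values `v k x` at the points `x` of the cell `k`. -/
def spaceSeminorm (a : T.FE d W) (v : Fin T.n → Eu D → W) : ℝ :=
  √(∑ σ, T.mass d σ *
    (⨆ k : T.cellsOf d σ, ⨆ x : T.cell k, ‖a σ - v k x‖ / Metric.diam (T.cell k)) ^ 2)

/-- The temporal seminorm
`|a|²_{1,t} = ∑_σ |C_σ| (max_{m=1,…,N} |a^m_σ - a^{m-1}_σ| / Δt^m)²`, where `Δt^m = t^m - t^0`. -/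
def timeSeminorm {N : ℕ} (t : Fin (N + 1) → ℝ) (a : Fin (N + 1) → T.FE d W) : ℝ :=
  √(∑ σ, T.mass d σ *
    (⨆ m : Fin N, ‖a m.succ σ - a m.castSucc σ‖ / (t m.succ - t 0)) ^ 2)

/-- The regularity bounds `|v^m|_{1,x} ≤ C₁ ‖v^m‖` for `m = 0, …, N` and
`|v|_{1,t} ≤ C₂ |||v|||`, for a time-discrete field `v` with coefficients `a` and values `v`. -/
def SeminormBounds {N : ℕ} (C₁ C₂ : ℝ) (t : Fin (N + 1) → ℝ) (a : Fin (N + 1) → T.FE d W)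
    (v : Fin (N + 1) → Fin T.n → Eu D → W) : Prop :=
  (∀ m, T.spaceSeminorm (a m) (v m) ≤ C₁ * T.norm (a m)) ∧
    T.timeSeminorm t a ≤ C₂ * T.tripleNorm a

end Fields

end Mesh

/-! ### Residuals -/

/-- The advection term `∑_e Λ_e ∂_{x_e} f` on the cell `k`, where `Λ_e` is the diagonal matrix with
diagonal `Λ e`. -/
def advection {D L d : ℕ} (Λ : Fin D → Fin L → ℝ) (T : Mesh D) (f : T.FE d (Eu L)) (k : Fin T.n)
    (x : Eu D) : Eu L :=
  ∑ e : Fin D, Matrix.toEuclideanLin (Matrix.diagonal (Λ e))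
    (fderiv ℝ (T.eval f k) x (EuclideanSpace.single e 1))

/-- Nodal residuals `φ^K_σ` for the advection term: any splitting of the element residual
`∫_K ∑_e Λ_e ∂_{x_e} f` among the degrees of freedom of `K`, possibly nonlinear in `f`. -/
structure AdvectionResidual {D L : ℕ} (Λ : Fin D → Fin L → ℝ) (T : Mesh D) (d : ℕ) where
  /-- the nodal residual of the cell `k` and the degree of freedom `σ` -/
  res : Fin T.n → T.dofs d → T.FE d (Eu L) → Eu L
  sum_res : ∀ (k : Fin T.n) (f : T.FE d (Eu L)),
    ∑ σ with k ∈ T.cellsOf d σ, res k σ f = ∫ x in T.cell k, advection Λ T f k x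

/-- The Galerkin nodal residual `-(1/ε) ∫_K φ_σ (M(P f) - f)` of the relaxation source. -/
def sourceResidual {D L K d : ℕ} (P : Eu L →L[ℝ] Eu K) (Mx : Eu K → Eu L) (ε : ℝ) (T : Mesh D)
    (k : Fin T.n) (σ : T.dofs d) (f : T.FE d (Eu L)) : Eu L :=
  -((1 / ε) • ∫ x in T.cell k,
    T.shape d k σ x • (Mx (P (T.eval f k x)) - T.eval f k x))

/-- The interpolation polynomial of the values `a` at the times `t`, evaluated at time `s`. -/
def timeInterp {N : ℕ} {W : Type} [NormedAddCommGroup W] [NormedSpace ℝ W]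
    (t : Fin (N + 1) → ℝ) (a : Fin (N + 1) → W) (s : ℝ) : W :=
  ∑ r, (Lagrange.basis Finset.univ t r).eval s • a r

/-! ### The operators
In all of them `m : Fin N` stands for the subtimestep `m + 1`, and `Δt^m = t^m - t^0`. -/

section Operators

variable {D L K d N : ℕ} {Λ : Fin D → Fin L → ℝ}

/-- The low order IMEX operator for `f`, in its explicit form (the `f`-equation divided by
`|C_σ| (1 + Δt^m / ε)`), with `u = P f`. -/
def L1 (P : Eu L →L[ℝ] Eu K) (Mx : Eu K → Eu L) (ε : ℝ) (t : Fin (N + 1) → ℝ) (T : Mesh D)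
    (φ : AdvectionResidual Λ T d) (f : Fin (N + 1) → T.FE d (Eu L)) (m : Fin N) :
    T.FE d (Eu L) := fun σ =>
  let δ : ℝ := t m.succ - t 0
  f m.succ σ - (ε / (ε + δ)) • f 0 σ
    + (ε * δ / (T.mass d σ * (ε + δ))) • ∑ k ∈ T.cellsOf d σ, φ.res k σ (f 0)
    - (δ / (ε + δ)) • Mx (P (f m.succ σ))

/-- The high order operator for `f`, with the same normalization as `L1`. -/
def L2 (P : Eu L →L[ℝ] Eu K) (Mx : Eu K → Eu L) (ε : ℝ) (t : Fin (N + 1) → ℝ) (T : Mesh D)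
    (φ : AdvectionResidual Λ T d) (f : Fin (N + 1) → T.FE d (Eu L)) (m : Fin N) :
    T.FE d (Eu L) := fun σ =>
  let δ : ℝ := t m.succ - t 0
  (ε / (T.mass d σ * (ε + δ))) • ∑ k ∈ T.cellsOf d σ,
    ((∫ x in T.cell k, T.shape d k σ x • (T.eval (f m.succ) k x - T.eval (f 0) k x))
      + ∫ s in (t 0)..(t m.succ),
          timeInterp t (fun r => φ.res k σ (f r) + sourceResidual P Mx ε T k σ (f r)) s)

/-- The low order operator for `u = P f` (the `u`-equation divided by `|C_σ|`). -/
def L1u (P : Eu L →L[ℝ] Eu K) (t : Fin (N + 1) → ℝ) (T : Mesh D)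
    (φ : AdvectionResidual Λ T d) (f : Fin (N + 1) → T.FE d (Eu L)) (m : Fin N) :
    T.FE d (Eu K) := fun σ =>
  P (f m.succ σ) - P (f 0 σ)
    + ((t m.succ - t 0) / T.mass d σ) • ∑ k ∈ T.cellsOf d σ, P (φ.res k σ (f 0))

/-- The high order operator for `u = P f`, with the same normalization as `L1u`. -/
def L2u (P : Eu L →L[ℝ] Eu K) (t : Fin (N + 1) → ℝ) (T : Mesh D)
    (φ : AdvectionResidual Λ T d) (f : Fin (N + 1) → T.FE d (Eu L)) (m : Fin N) :
    T.FE d (Eu K) := fun σ =>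
  (1 / T.mass d σ) • ∑ k ∈ T.cellsOf d σ,
    ((∫ x in T.cell k,
        T.shape d k σ x • (P (T.eval (f m.succ) k x) - P (T.eval (f 0) k x)))
      + ∫ s in (t 0)..(t m.succ), timeInterp t (fun r => P (φ.res k σ (f r))) s)

/-- The Lipschitz condition on the nodal residuals at the pair `f, g`:
`∑_σ |C_σ|⁻¹ |∑_{K ∋ σ} (φ^K_σ(f) - φ^K_σ(g))|² ≤ C₃ ‖f - g‖²`. -/
def ResidualLipschitz (C₃ : ℝ) (T : Mesh D) (φ : AdvectionResidual Λ T d)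
    (f g : T.FE d (Eu L)) : Prop :=
  ∑ σ, 1 / T.mass d σ * ‖∑ k ∈ T.cellsOf d σ, (φ.res k σ f - φ.res k σ g)‖ ^ 2 ≤
    C₃ * T.norm (f - g) ^ 2

/-- The same condition for the `u`-equation, whose nodal residuals are `P φ^K_σ` and whose unknown
is `P f`. -/
def ResidualLipschitzU (P : Eu L →L[ℝ] Eu K) (C₃ : ℝ) (T : Mesh D)
    (φ : AdvectionResidual Λ T d) (f g : T.FE d (Eu L)) : Prop :=
  ∑ σ, 1 / T.mass d σ * ‖∑ k ∈ T.cellsOf d σ, (P (φ.res k σ f) - P (φ.res k σ g))‖ ^ 2 ≤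
    C₃ * T.norm (fun σ => P (f σ) - P (g σ)) ^ 2

end Operators

end KineticRD

end

namespace KineticRD

/-! ### Cells, shape functions and the weighted norms. -/

namespace Mesh

variable {D d N : ℕ} (T : Mesh D) {W : Type} [NormedAddCommGroup W]

/-! The low and high order operators differ by mass lumping and by time quadrature, and each costs
one power of `Δ`. Lumping replaces a mean against `φ_σ` by the coefficient `v_σ`. Since `φ_σ ≥ 0`
has total mass `|C_σ|`, the error is a mean of `v_σ - v(x)`, at most `h` times the spatial seminorm
(`norm_sub_cellMean_le`). For advection no cancellation is needed: Euler and quadrature terms are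
each of size `Δt` times the Lipschitz bound on the residuals (`norm_advection_defect_le`).

The stiff source needs more. After normalization its prefactor is `1 / (ε + δ)` with `δ = Δt^m`, and
the quadrature weights have total size `O(δ)`; together these are only bounded, uniformly in `ε`.
The missing power of `Δ` comes from exactness of the quadrature on constants: it turns the source
defect into a weighted sum of time differences and lumping errors, for `f - g` and for `M(P f) - M(P
g)` (`kinetic_defect_eq`). Both are small by the regularity assumptions. -/

theorem isCompact_cell (k : Fin T.n) : IsCompact (T.cell k) :=
  (Set.finite_range (T.simplex k)).isCompact_convexHull ℝ

theorem measurableSet_cell (k : Fin T.n) : MeasurableSet (T.cell k) :=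
  (T.isCompact_cell k).isClosed.measurableSet

theorem diam_cell_pos (hD : 1 ≤ D) (k : Fin T.n) : 0 < Metric.diam (T.cell k) := by
  have hne : T.simplex k 0 ≠ T.simplex k (Fin.last D) := fun h => by
    have := congrArg Fin.val ((T.simplex k).ind.injective h)
    simp at this
    omega
  have hmem : ∀ i, T.simplex k i ∈ T.cell k := fun i =>
    subset_convexHull ℝ _ (Set.mem_range_self i)
  exact (dist_pos.2 hne).trans_le
    (Metric.dist_le_diam_of_mem (T.isCompact_cell k).isBounded (hmem _) (hmem _))

theorem diam_cell_le_h (k : Fin T.n) : Metric.diam (T.cell k) ≤ T.h :=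
  le_ciSup (f := fun k => Metric.diam (T.cell k)) (Set.finite_range _).bddAbove k

theorem h_nonneg : 0 ≤ T.h := Real.iSup_nonneg fun _ => Metric.diam_nonneg

theorem continuous_shape (k : Fin T.n) (σ : T.dofs d) : Continuous (T.shape d k σ) := by
  unfold shape
  split_ifs
  · exact continuous_const.mul (continuous_finsetProd _ fun i _ =>
      (AffineMap.continuous_of_finiteDimensional ((T.simplex k).coord i)).pow _)
  · exact continuous_const

theorem shape_nonneg {k : Fin T.n} (σ : T.dofs d) {x : Eu D} (hx : x ∈ T.cell k) :
    0 ≤ T.shape d k σ x := by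
  unfold shape
  split_ifs
  · rw [cell, (T.simplex k).convexHull_eq_nonneg_coord] at hx
    exact mul_nonneg (Nat.cast_nonneg _) (Finset.prod_nonneg fun i _ => pow_nonneg (hx i) _)
  · exact le_rfl

theorem mass_nonneg (σ : T.dofs d) : 0 ≤ T.mass d σ :=
  Finset.sum_nonneg fun k _ =>
    setIntegral_nonneg (T.measurableSet_cell k) fun _ hx => T.shape_nonneg σ hx

theorem norm_nonneg (a : T.FE d W) : 0 ≤ T.norm a := Real.sqrt_nonneg _

/-- Degrees of freedom without mass do not contribute to the norm. -/
theorem norm_le_norm {W' : Type} [NormedAddCommGroup W'] {a : T.FE d W}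
    {b : T.FE d W'} (hab : ∀ σ, 0 < T.mass d σ → ‖a σ‖ ≤ ‖b σ‖) : T.norm a ≤ T.norm b := by
  refine Real.sqrt_le_sqrt (Finset.sum_le_sum fun σ _ => ?_)
  rcases (T.mass_nonneg σ).eq_or_lt with h | h
  · simp [← h]
  · have := hab σ h
    gcongr

theorem norm_le_stepNorm (b : Fin N → T.FE d W) (m : Fin N) : T.norm (b m) ≤ T.stepNorm b :=
  Real.le_sqrt_of_sq_le
    (Finset.single_le_sum (f := fun m => T.norm (b m) ^ 2) (fun _ _ => sq_nonneg _)
      (Finset.mem_univ m))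

theorem stepNorm_le {b : Fin N → T.FE d W} {c : ℝ} (hc : 0 ≤ c) (hb : ∀ m, T.norm (b m) ≤ c) :
    T.stepNorm b ≤ N * c := by
  refine Real.sqrt_le_iff.2 ⟨by positivity, ?_⟩
  calc ∑ m, T.norm (b m) ^ 2 ≤ ∑ _m : Fin N, c ^ 2 :=
        Finset.sum_le_sum fun m _ => pow_le_pow_left₀ (T.norm_nonneg _) (hb m) 2
    _ = N * c ^ 2 := by simp
    _ ≤ (N : ℝ) ^ 2 * c ^ 2 := by
        have : (N : ℝ) ≤ (N : ℝ) ^ 2 := by exact_mod_cast Nat.le_self_pow two_ne_zero N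
        gcongr
    _ = (N * c) ^ 2 := by ring

theorem stepNorm_mono {W' : Type} [NormedAddCommGroup W'] {a : Fin N → T.FE d W}
    {b : Fin N → T.FE d W'} (hab : ∀ m, T.norm (a m) ≤ T.norm (b m)) :
    T.stepNorm a ≤ T.stepNorm b :=
  Real.sqrt_le_sqrt (Finset.sum_le_sum fun m _ =>
    pow_le_pow_left₀ (T.norm_nonneg _) (hab m) 2)

theorem tripleNorm_nonneg (a : Fin (N + 1) → T.FE d W) : 0 ≤ T.tripleNorm a := Real.sqrt_nonneg _

/-- Seen as the norm of a scalar nodal field, the seminorm can be compared node by node through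
`norm_le_norm`. -/
theorem spaceSeminorm_eq (a : T.FE d W) (v : Fin T.n → Eu D → W) :
    T.spaceSeminorm a v = T.norm (fun σ =>
      ⨆ k : T.cellsOf d σ, ⨆ x : T.cell k, ‖a σ - v k x‖ / Metric.diam (T.cell k)) := by
  simp [spaceSeminorm, norm]

theorem timeSeminorm_eq (t : Fin (N + 1) → ℝ) (a : Fin (N + 1) → T.FE d W) :
    T.timeSeminorm t a = T.norm (fun σ =>
      ⨆ m : Fin N, ‖a m.succ σ - a m.castSucc σ‖ / (t m.succ - t 0)) := by
  simp [timeSeminorm, norm]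

variable [NormedSpace ℝ W]

theorem continuous_eval (f : T.FE d W) (k : Fin T.n) : Continuous (T.eval f k) :=
  continuous_finsetSum _ fun σ _ => (T.continuous_shape k σ).smul continuous_const

theorem integrableOn_shape_smul (k : Fin T.n) (σ : T.dofs d) {v : Eu D → W} (hv : Continuous v) :
    IntegrableOn (fun x => T.shape d k σ x • v x) (T.cell k) :=
  ((T.continuous_shape k σ).smul hv).continuousOn.integrableOn_compact (T.isCompact_cell k)

/-- Scaling by `√|C_σ|` embeds the coefficients in an `ℓ²` product, from which homogeneity and the
triangle inequality are inherited. -/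
theorem norm_eq_piLp (a : T.FE d W) :
    T.norm a = ‖WithLp.toLp 2 (fun σ => √(T.mass d σ) • a σ)‖ := by
  rw [PiLp.norm_eq_of_L2, norm]
  congr 1
  refine Finset.sum_congr rfl fun σ _ => ?_
  rw [norm_smul, mul_pow, Real.norm_eq_abs, sq_abs, Real.sq_sqrt (T.mass_nonneg σ)]

theorem norm_add_le (a b : T.FE d W) : T.norm (a + b) ≤ T.norm a + T.norm b := by
  simp only [norm_eq_piLp]
  refine le_trans (le_of_eq ?_) (_root_.norm_add_le _ _)
  congr 1
  ext σ
  simp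

theorem norm_smul (c : ℝ) (a : T.FE d W) : T.norm (c • a) = |c| * T.norm a := by
  simp only [norm_eq_piLp]
  rw [← Real.norm_eq_abs, ← _root_.norm_smul]
  congr 1
  ext σ
  simp [smul_comm c]

theorem norm_zero : T.norm (0 : T.FE d W) = 0 := by simpa using T.norm_smul 0 (0 : T.FE d W)

theorem norm_sub_le (a b : T.FE d W) : T.norm (a - b) ≤ T.norm a + T.norm b := by
  have h := T.norm_add_le a ((-1 : ℝ) • b)
  rwa [norm_smul, abs_neg, abs_one, one_mul, neg_one_smul, ← sub_eq_add_neg] at h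

theorem norm_sum_le {ι : Type*} (s : Finset ι) (a : ι → T.FE d W) :
    T.norm (∑ i ∈ s, a i) ≤ ∑ i ∈ s, T.norm (a i) := by
  classical
  induction s using Finset.induction_on with
  | empty => simp [T.norm_zero]
  | insert i s hi ih =>
    rw [Finset.sum_insert hi, Finset.sum_insert hi]
    exact (T.norm_add_le _ _).trans (add_le_add_right ih _)

theorem stepNorm_smul (c : ℝ) (a : Fin N → T.FE d W) :
    T.stepNorm (fun m => c • a m) = |c| * T.stepNorm a := by
  simp only [stepNorm, norm_smul, mul_pow, ← Finset.mul_sum]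
  rw [Real.sqrt_mul (sq_nonneg _), Real.sqrt_sq (abs_nonneg c)]

/-! ### Cell means, nodal means and the lumping error. -/

/-- The mean value `|C_σ|⁻¹ ∑_{K ∋ σ} ∫_K φ_σ v` of a piecewise defined field. -/
noncomputable def cellMean (d : ℕ) (v : Fin T.n → Eu D → W) : T.FE d W := fun σ =>
  (1 / T.mass d σ) • ∑ k ∈ T.cellsOf d σ, ∫ x in T.cell k, T.shape d k σ x • v k x

/-- The nodal average `|C_σ|⁻¹ ∑_{K ∋ σ} r^K_σ`. -/
noncomputable def nodalMean (r : Fin T.n → T.dofs d → W) : T.FE d W := fun σ =>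
  (1 / T.mass d σ) • ∑ k ∈ T.cellsOf d σ, r k σ

theorem cellMean_sub {v w : Fin T.n → Eu D → W} (hv : ∀ k, Continuous (v k))
    (hw : ∀ k, Continuous (w k)) :
    T.cellMean d (fun k x => v k x - w k x) = T.cellMean d v - T.cellMean d w := by
  ext1 σ
  simp only [cellMean, Pi.sub_apply, ← smul_sub, ← Finset.sum_sub_distrib]
  congr 1
  refine Finset.sum_congr rfl fun k _ => ?_
  simp only [smul_sub]
  exact integral_sub (T.integrableOn_shape_smul k σ (hv k)) (T.integrableOn_shape_smul k σ (hw k))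

theorem nodalMean_sub (r s : Fin T.n → T.dofs d → W) :
    T.nodalMean (fun k σ => r k σ - s k σ) = T.nodalMean r - T.nodalMean s := by
  ext1 σ
  simp [nodalMean, ← smul_sub, Finset.sum_sub_distrib]

theorem norm_nodalMean_sq (r : Fin T.n → T.dofs d → W) :
    T.norm (T.nodalMean r) ^ 2 = ∑ σ, 1 / T.mass d σ * ‖∑ k ∈ T.cellsOf d σ, r k σ‖ ^ 2 := by
  rw [norm, Real.sq_sqrt
    (Finset.sum_nonneg fun σ _ => mul_nonneg (T.mass_nonneg σ) (sq_nonneg _))]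
  refine Finset.sum_congr rfl fun σ _ => ?_
  rw [nodalMean, _root_.norm_smul, mul_pow, Real.norm_eq_abs, sq_abs]
  -- A node of zero mass contributes zero to both sides, because `1 / 0 = 0`.
  rcases (T.mass_nonneg σ).eq_or_lt with h | h
  · simp [← h]
  · field_simp

/-- A mean with nonnegative weights of total mass `|C_σ|` deviates from `a σ` by at most the largest
pointwise deviation, which is a cell diameter times the supremum in the seminorm. -/
theorem norm_sub_cellMean_le [CompleteSpace W] (hD : 1 ≤ D) (a : T.FE d W)
    {v : Fin T.n → Eu D → W} (hv : ∀ k, Continuous (v k)) :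
    T.norm (a - T.cellMean d v) ≤ T.h * T.spaceSeminorm a v := by
  rw [spaceSeminorm_eq, ← abs_of_nonneg T.h_nonneg, ← norm_smul]
  refine T.norm_le_norm fun σ hσ => ?_
  set S : ℝ := ⨆ k : T.cellsOf d σ, ⨆ x : T.cell k, ‖a σ - v k x‖ / Metric.diam (T.cell k)
    with hS
  have hS0 : 0 ≤ S := Real.iSup_nonneg fun k => Real.iSup_nonneg fun x => by positivity
  have hpt : ∀ k ∈ T.cellsOf d σ, ∀ x ∈ T.cell k, ‖a σ - v k x‖ ≤ T.h * S := fun k hk x hx => by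
    -- A real supremum bounds its terms only if they are bounded above; compactness of the cell and
    -- continuity of `v k` provide this.
    have hbdd : BddAbove (Set.range fun x : T.cell k =>
        ‖a σ - v k x‖ / Metric.diam (T.cell k)) := by
      rw [← Set.image_eq_range (fun x => ‖a σ - v k x‖ / Metric.diam (T.cell k))]
      exact (T.isCompact_cell k).bddAbove_image
        ((continuous_const.sub (hv k)).norm.div_const _).continuousOn
    have h1 : ‖a σ - v k x‖ / Metric.diam (T.cell k) ≤ S :=
      (le_ciSup hbdd ⟨x, hx⟩).trans
        (le_ciSup (f := fun k : T.cellsOf d σ => ⨆ x : T.cell k,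
          ‖a σ - v k x‖ / Metric.diam (T.cell k)) (Set.finite_range _).bddAbove ⟨k, hk⟩)
    rw [div_le_iff₀ (T.diam_cell_pos hD k), mul_comm] at h1
    exact h1.trans (mul_le_mul_of_nonneg_right (T.diam_cell_le_h k) hS0)
  have hint : ∀ k, IntegrableOn (T.shape d k σ) (T.cell k) := fun k =>
    (T.continuous_shape k σ).continuousOn.integrableOn_compact (T.isCompact_cell k)
  have hrepr : (a - T.cellMean d v) σ = (1 / T.mass d σ) •
      ∑ k ∈ T.cellsOf d σ, ∫ x in T.cell k, T.shape d k σ x • (a σ - v k x) := by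
    -- A constant is its own weighted mean, as the weights integrate to the mass.
    have : a σ = (1 / T.mass d σ) •
        ∑ k ∈ T.cellsOf d σ, ∫ x in T.cell k, T.shape d k σ x • a σ := by
      simp only [integral_smul_const, ← Finset.sum_smul]
      rw [← mass, smul_smul, one_div_mul_cancel hσ.ne', one_smul]
    rw [Pi.sub_apply, cellMean]
    nth_rewrite 1 [this]
    rw [← smul_sub, ← Finset.sum_sub_distrib]
    congr 1
    refine Finset.sum_congr rfl fun k _ => ?_
    simp only [smul_sub]
    rw [integral_sub (T.integrableOn_shape_smul k σ continuous_const)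
      (T.integrableOn_shape_smul k σ (hv k))]
  have hsum : ‖∑ k ∈ T.cellsOf d σ, ∫ x in T.cell k, T.shape d k σ x • (a σ - v k x)‖ ≤
      T.mass d σ * (T.h * S) := by
    rw [mass, Finset.sum_mul]
    refine norm_sum_le_of_le _ fun k hk => ?_
    rw [← integral_mul_const]
    refine norm_integral_le_of_norm_le ((hint k).mul_const _) ?_
    filter_upwards [ae_restrict_mem (T.measurableSet_cell k)] with x hx
    rw [_root_.norm_smul, Real.norm_of_nonneg (T.shape_nonneg σ hx)]
    exact mul_le_mul_of_nonneg_left (hpt k hk x hx) (T.shape_nonneg σ hx)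
  rw [hrepr, _root_.norm_smul, Real.norm_of_nonneg (by positivity)]
  simp only [Pi.smul_apply, smul_eq_mul]
  rw [Real.norm_of_nonneg (mul_nonneg T.h_nonneg hS0), div_mul_eq_mul_div, one_mul,
    div_le_iff₀ hσ, mul_comm _ (T.mass d σ)]
  exact hsum

/-! ### Differences in time. -/

theorem norm_sub_succ_le {V : Type} [NormedAddCommGroup V] {t : Fin (N + 1) → ℝ}
    (ht : StrictMono t) (a : Fin (N + 1) → T.FE d V) (m : Fin N) :
    T.norm (a m.succ - a m.castSucc) ≤ (t (Fin.last N) - t 0) * T.timeSeminorm t a := by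
  have hδ : ∀ m : Fin N, 0 < t m.succ - t 0 := fun m => sub_pos.2 (ht m.succ_pos)
  -- The seminorm divides by the time elapsed since `t 0`, not by the length of the substep, so the
  -- whole interval length serves as the common factor.
  have hlast : t m.succ - t 0 ≤ t (Fin.last N) - t 0 :=
    sub_le_sub_right (ht.monotone (Fin.le_last _)) _
  rw [timeSeminorm_eq, ← abs_of_nonneg ((hδ m).le.trans hlast), ← norm_smul]
  refine T.norm_le_norm fun σ _ => ?_
  set S : ℝ := ⨆ m : Fin N, ‖a m.succ σ - a m.castSucc σ‖ / (t m.succ - t 0)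
  have h1 : ‖a m.succ σ - a m.castSucc σ‖ / (t m.succ - t 0) ≤ S :=
    le_ciSup (f := fun m : Fin N => ‖a m.succ σ - a m.castSucc σ‖ / (t m.succ - t 0))
      (Set.finite_range _).bddAbove m
  have hS0 : 0 ≤ S := le_trans (div_nonneg (_root_.norm_nonneg _) (hδ m).le) h1
  rw [div_le_iff₀ (hδ m), mul_comm] at h1
  simp only [Pi.smul_apply, Pi.sub_apply, smul_eq_mul]
  rw [Real.norm_of_nonneg (mul_nonneg ((hδ m).le.trans hlast) hS0)]
  exact h1.trans (mul_le_mul_of_nonneg_right hlast hS0)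

theorem norm_sub_zero_le {t : Fin (N + 1) → ℝ} (ht : StrictMono t) (a : Fin (N + 1) → T.FE d W)
    (m : Fin (N + 1)) :
    T.norm (a m - a 0) ≤ m * ((t (Fin.last N) - t 0) * T.timeSeminorm t a) := by
  induction m using Fin.induction with
  | zero => simp [T.norm_zero]
  | succ m ih =>
    have h := T.norm_add_le (a m.succ - a m.castSucc) (a m.castSucc - a 0)
    rw [sub_add_sub_cancel] at h
    have := T.norm_sub_succ_le ht a m
    simp only [Fin.val_castSucc, Fin.val_succ, Nat.cast_add, Nat.cast_one] at ih ⊢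
    linarith

/-- Both values are compared with the one at time zero by at most `N` increments each, whence `2 *
N`. -/
theorem norm_sub_le_timeSeminorm {t : Fin (N + 1) → ℝ} (ht : StrictMono t)
    (a : Fin (N + 1) → T.FE d W) (m r : Fin (N + 1)) :
    T.norm (a m - a r) ≤ 2 * N * ((t (Fin.last N) - t 0) * T.timeSeminorm t a) := by
  have h := T.norm_sub_le (a m - a 0) (a r - a 0)
  rw [sub_sub_sub_cancel_right] at h
  have hX : 0 ≤ (t (Fin.last N) - t 0) * T.timeSeminorm t a :=
    mul_nonneg (sub_nonneg.2 (ht.monotone (Fin.zero_le _))) (Real.sqrt_nonneg _)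
  have hb : ∀ m : Fin (N + 1), T.norm (a m - a 0) ≤
      N * ((t (Fin.last N) - t 0) * T.timeSeminorm t a) := fun m =>
    (T.norm_sub_zero_le ht a m).trans
      (mul_le_mul_of_nonneg_right (by exact_mod_cast Nat.lt_succ_iff.1 m.isLt) hX)
  linarith [hb m, hb r]

end Mesh

/-! ### Interpolation in time -/

section Interpolation

variable {N : ℕ} {W : Type} [NormedAddCommGroup W] [NormedSpace ℝ W]

/-- The weight `∫_{t⁰}^{t^m} ℓ_r` of the interpolatory quadrature rule. -/
noncomputable def quadWeight (t : Fin (N + 1) → ℝ) (m r : Fin (N + 1)) : ℝ :=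
  ∫ s in (t 0)..(t m), (Lagrange.basis Finset.univ t r).eval s

theorem integral_timeInterp [CompleteSpace W] (t : Fin (N + 1) → ℝ) (a : Fin (N + 1) → W)
    (m : Fin (N + 1)) :
    ∫ s in (t 0)..(t m), timeInterp t a s = ∑ r, quadWeight t m r • a r := by
  simp only [timeInterp]
  rw [intervalIntegral.integral_finsetSum fun r _ => Continuous.intervalIntegrable
    (u := fun s => (Lagrange.basis Finset.univ t r).eval s • a r)
    ((Polynomial.continuous _).smul continuous_const) _ _]
  simp only [quadWeight, intervalIntegral.integral_smul_const]

/-- The Lagrange polynomials sum to one. This exactness on constants is what makes the source terms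
cancel to leading order. -/
theorem sum_quadWeight {t : Fin (N + 1) → ℝ} (ht : Function.Injective t) (m : Fin (N + 1)) :
    ∑ r, quadWeight t m r = t m - t 0 := by
  simp only [quadWeight]
  rw [← intervalIntegral.integral_finsetSum fun r _ =>
    (Polynomial.continuous _).intervalIntegrable _ _]
  simp only [← Polynomial.eval_finsetSum]
  rw [Lagrange.sum_basis ht.injOn Finset.univ_nonempty]
  simp

/-- A bound for the sum of the absolute values of the Lagrange polynomials on the interval spanned
by the nodes. -/
noncomputable def lagrangeBound (τ : Fin (N + 1) → ℝ) : ℝ :=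
  ∑ r, ∏ j ∈ Finset.univ.erase r, |τ r - τ j|⁻¹

theorem lagrangeBound_nonneg (τ : Fin (N + 1) → ℝ) : 0 ≤ lagrangeBound τ :=
  Finset.sum_nonneg fun _ _ => Finset.prod_nonneg fun _ _ => inv_nonneg.2 (abs_nonneg _)

/-- In each factor `(s - t_j) / (t_r - t_j)` the numerator is at most `c` and the denominator is
`(τ_r - τ_j) c`; the step length cancels, leaving a bound in the reference nodes alone. -/
theorem sum_abs_quadWeight_le {t τ : Fin (N + 1) → ℝ} {t₀ c : ℝ} (hc : 0 < c)
    (ht : ∀ m, t m = t₀ + τ m * c) (hτ : StrictMono τ) (hτ0 : τ 0 = 0)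
    (hτ1 : τ (Fin.last N) = 1) (m : Fin (N + 1)) :
    ∑ r, |quadWeight t m r| ≤ lagrangeBound τ * (t m - t 0) := by
  have hτm : ∀ j, 0 ≤ τ j ∧ τ j ≤ 1 := fun j =>
    ⟨hτ0 ▸ hτ.monotone (Fin.zero_le j), hτ1 ▸ hτ.monotone (Fin.le_last j)⟩
  have hle : t 0 ≤ t m := by
    rw [ht, ht, hτ0]
    have := mul_nonneg (hτm m).1 hc.le
    linarith
  rw [lagrangeBound, Finset.sum_mul]
  refine Finset.sum_le_sum fun r _ => ?_
  rw [← Real.norm_eq_abs, ← abs_of_nonneg (sub_nonneg.2 hle)]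
  refine intervalIntegral.norm_integral_le_of_norm_le_const fun s hs => ?_
  rw [Set.uIoc_of_le hle] at hs
  rw [Lagrange.basis, Polynomial.eval_prod, Real.norm_eq_abs, Finset.abs_prod]
  refine Finset.prod_le_prod (fun _ _ => abs_nonneg _) fun j _ => ?_
  have h1 : |s - t j| ≤ c := by
    have h3 := mul_le_of_le_one_left hc.le (hτm m).2
    have h4 := mul_le_of_le_one_left hc.le (hτm j).2
    have h5 := mul_nonneg (hτm j).1 hc.le
    have h6 := hs.1
    have h7 := hs.2
    rw [ht] at h6 h7
    rw [hτ0] at h6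
    rw [ht, abs_le]
    constructor <;> linarith
  have h2 : t r - t j = (τ r - τ j) * c := by rw [ht, ht]; ring
  rw [Lagrange.basisDivisor, h2]
  simp only [Polynomial.eval_mul, Polynomial.eval_C, Polynomial.eval_sub, Polynomial.eval_X]
  rw [abs_mul, abs_inv, abs_mul, abs_of_pos hc, mul_inv, mul_assoc]
  refine mul_le_of_le_one_right (inv_nonneg.2 (abs_nonneg _)) ?_
  rw [inv_mul_le_one₀ hc]
  exact h1

end Interpolation

end KineticRD

namespace KineticRD

namespace Mesh

variable {D d N : ℕ} (T : Mesh D) {W : Type} [NormedAddCommGroup W] [NormedSpace ℝ W]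

/-! ### Bounds for regular fields -/

section Regular

variable {C₁ C₂ η S : ℝ} {t : Fin (N + 1) → ℝ} {a : Fin (N + 1) → T.FE d W}
  {v : Fin (N + 1) → Fin T.n → Eu D → W}

theorem SeminormBounds.mono {T : Mesh D} {V : Type} [NormedAddCommGroup V]
    {a : Fin (N + 1) → T.FE d V} {v : Fin (N + 1) → Fin T.n → Eu D → V} {C₁' C₂' : ℝ} (h₁ : C₁ ≤ C₁') (h₂ : C₂ ≤ C₂')
    (h : T.SeminormBounds C₁ C₂ t a v) : T.SeminormBounds C₁' C₂' t a v :=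
  ⟨fun m => (h.1 m).trans (mul_le_mul_of_nonneg_right h₁ (T.norm_nonneg _)),
    h.2.trans (mul_le_mul_of_nonneg_right h₂ (T.tripleNorm_nonneg _))⟩

theorem norm_sub_le_of_seminormBounds (ht : StrictMono t) (hS : t (Fin.last N) - t 0 ≤ S)
    (h : T.SeminormBounds C₁ C₂ t a v) (m r : Fin (N + 1)) :
    T.norm (a m - a r) ≤ 2 * N * C₂ * S * T.tripleNorm a := by
  have h0 : 0 ≤ t (Fin.last N) - t 0 := sub_nonneg.2 (ht.monotone (Fin.zero_le _))
  calc T.norm (a m - a r) ≤ 2 * N * ((t (Fin.last N) - t 0) * T.timeSeminorm t a) :=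
        T.norm_sub_le_timeSeminorm ht a m r
    _ ≤ 2 * N * (S * (C₂ * T.tripleNorm a)) := by
        gcongr
        · exact Real.sqrt_nonneg _
        · exact h0.trans hS
        · exact h.2
    _ = _ := by ring

/-- The triple norm omits time zero, yet the operators use the initial value. Passing through the
last node, whose norm it does control, costs one time difference; the bound `S` on the interval
keeps the constant uniform. -/
theorem norm_le_of_seminormBounds (hN : 0 < N) (ht : StrictMono t)
    (hS : t (Fin.last N) - t 0 ≤ S) (h : T.SeminormBounds C₁ C₂ t a v) (r : Fin (N + 1)) :
    T.norm (a r) ≤ (1 + 2 * N * C₂ * S) * T.tripleNorm a := by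
  obtain ⟨n, rfl⟩ := Nat.exists_eq_add_one.2 hN
  have h1 := T.norm_add_le (a r - a (Fin.last n).succ) (a (Fin.last n).succ)
  rw [sub_add_cancel] at h1
  have h2 := T.norm_sub_le_of_seminormBounds ht hS h r (Fin.last n).succ
  have h3 : T.norm (a (Fin.last n).succ) ≤ T.tripleNorm a :=
    T.norm_le_stepNorm (fun m => a m.succ) (Fin.last n)
  linarith

theorem norm_sub_cellMean_le_of_seminormBounds [CompleteSpace W] (hD : 1 ≤ D) (hN : 0 < N)
    (hC₁ : 0 ≤ C₁) (ht : StrictMono t) (hS : t (Fin.last N) - t 0 ≤ S) (hη : T.h ≤ η)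
    (hv : ∀ m k, Continuous (v m k)) (h : T.SeminormBounds C₁ C₂ t a v) (r : Fin (N + 1)) :
    T.norm (a r - T.cellMean d (v r)) ≤
      η * (C₁ * ((1 + 2 * N * C₂ * S) * T.tripleNorm a)) := by
  refine (T.norm_sub_cellMean_le hD (a r) (hv r)).trans ?_
  refine mul_le_mul hη ?_ (Real.sqrt_nonneg _) (T.h_nonneg.trans hη)
  exact (h.1 r).trans
    (mul_le_mul_of_nonneg_left (T.norm_le_of_seminormBounds hN ht hS h r) hC₁)

end Regular

theorem norm_sum_smul_le {c : Fin (N + 1) → ℝ} {q : Fin (N + 1) → T.FE d W} {β γ : ℝ}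
    (hβ : 0 ≤ β) (hc : ∑ r, |c r| ≤ γ) (hq : ∀ r, T.norm (q r) ≤ β) :
    T.norm (∑ r, c r • q r) ≤ γ * β := by
  refine (T.norm_sum_le _ _).trans ?_
  refine le_trans (Finset.sum_le_sum fun r _ => ?_)
    ((Finset.sum_mul _ _ _).symm.le.trans (mul_le_mul_of_nonneg_right hc hβ))
  rw [norm_smul]
  exact mul_le_mul_of_nonneg_left (hq r) (abs_nonneg _)

/-- The `q r` need not be close to each other: the factor `δ` alone makes the quadrature part first
order, while `A` and `A₀` stand for lumping errors. -/
theorem norm_advection_defect_le {c : Fin (N + 1) → ℝ} {A A₀ : T.FE d W}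
    {q : Fin (N + 1) → T.FE d W} {α β B δ : ℝ} (hβ : 0 ≤ β) (hδ : 0 ≤ δ)
    (hc : ∑ r, |c r| ≤ B * δ) (hA : T.norm A ≤ α) (hA₀ : T.norm A₀ ≤ α)
    (hq : ∀ r, T.norm (q r) ≤ β) :
    T.norm ((A - A₀) + (δ • q 0 - ∑ r, c r • q r)) ≤ 2 * α + (1 + B) * δ * β := by
  have h1 := T.norm_add_le (A - A₀) (δ • q 0 - ∑ r, c r • q r)
  have h2 := T.norm_sub_le A A₀
  have h3 := T.norm_sub_le (δ • q 0) (∑ r, c r • q r)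
  have h4 := T.norm_sum_smul_le hβ hc hq
  rw [norm_smul, abs_of_nonneg hδ] at h3
  have h5 := mul_le_mul_of_nonneg_left (hq 0) hδ
  linarith

end Mesh

/-! ### The operators in terms of mean values -/

section Operators

variable {D L K d N : ℕ} {Λ : Fin D → Fin L → ℝ} (P : Eu L →L[ℝ] Eu K)
  (Mx : Eu K → Eu L) (ε : ℝ) (t : Fin (N + 1) → ℝ) (T : Mesh D) (φ : AdvectionResidual Λ T d)
  (f g : Fin (N + 1) → T.FE d (Eu L)) (m : Fin N)

theorem L1u_eq : L1u P t T φ f m = (fun σ => P (f m.succ σ)) - (fun σ => P (f 0 σ)) +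
    (t m.succ - t 0) • T.nodalMean (fun k σ => P (φ.res k σ (f 0))) := by
  ext1 σ
  simp only [L1u, Mesh.nodalMean, Pi.add_apply, Pi.sub_apply, Pi.smul_apply, smul_smul,
    mul_one_div]

theorem L2u_eq : L2u P t T φ f m =
    T.cellMean d (fun k x => P (T.eval (f m.succ) k x)) -
      T.cellMean d (fun k x => P (T.eval (f 0) k x)) +
    ∑ r, quadWeight t m.succ r • T.nodalMean (fun k σ => P (φ.res k σ (f r))) := by
  have hP : ∀ r k, Continuous fun x => P (T.eval (f r) k x) := fun r k =>
    P.continuous.comp (T.continuous_eval _ k)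
  rw [← T.cellMean_sub (hP _) (hP _)]
  ext1 σ
  simp only [L2u, Mesh.cellMean, Mesh.nodalMean, Pi.add_apply, Finset.sum_apply, Pi.smul_apply,
    integral_timeInterp, Finset.sum_add_distrib, smul_add]
  congr 1
  rw [Finset.sum_comm, Finset.smul_sum]
  refine Finset.sum_congr rfl fun r _ => ?_
  rw [← Finset.smul_sum, smul_comm]

theorem L1_eq : L1 P Mx ε t T φ f m =
    f m.succ - (ε / (ε + (t m.succ - t 0))) • f 0 +
      (ε / (ε + (t m.succ - t 0))) • (t m.succ - t 0) • T.nodalMean (fun k σ => φ.res k σ (f 0)) -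
      ((t m.succ - t 0) / (ε + (t m.succ - t 0))) • (fun σ => Mx (P (f m.succ σ))) := by
  ext1 σ
  simp only [L1, Mesh.nodalMean, Pi.add_apply, Pi.sub_apply, Pi.smul_apply, smul_smul]
  congr 4
  simp only [div_eq_mul_inv, mul_inv]
  ring

variable {Mx} in
-- The normalization `ε / (ε + δ)` absorbs the `1 / ε` of the source residual, so stiffness survives
-- only as `1 / (ε + δ)`.
theorem L2_eq (hM : Continuous Mx) (hε : ε ≠ 0) : L2 P Mx ε t T φ f m =
    (ε / (ε + (t m.succ - t 0))) •
      (T.cellMean d (T.eval (f m.succ)) - T.cellMean d (T.eval (f 0)) +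
        ∑ r, quadWeight t m.succ r • T.nodalMean (fun k σ => φ.res k σ (f r))) -
    (1 / (ε + (t m.succ - t 0))) • ∑ r, quadWeight t m.succ r •
      (T.cellMean d (fun k x => Mx (P (T.eval (f r) k x))) - T.cellMean d (T.eval (f r))) := by
  have hMP : ∀ r k, Continuous fun x => Mx (P (T.eval (f r) k x)) := fun r k =>
    hM.comp (P.continuous.comp (T.continuous_eval _ k))
  simp only [← T.cellMean_sub (hMP _) (T.continuous_eval _)]
  rw [← T.cellMean_sub (T.continuous_eval _) (T.continuous_eval _)]
  ext1 σ
  simp only [L2, sourceResidual, Mesh.cellMean, Mesh.nodalMean, Pi.add_apply, Pi.sub_apply,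
    Finset.sum_apply, Pi.smul_apply, integral_timeInterp, Finset.sum_add_distrib, smul_add]
  rw [Finset.sum_comm, Finset.sum_comm (s := T.cellsOf d σ)]
  simp only [← Finset.smul_sum, Finset.sum_neg_distrib]
  have hc : ε / (T.mass d σ * (ε + (t m.succ - t 0))) =
      ε / (ε + (t m.succ - t 0)) * (1 / T.mass d σ) := by
    simp only [div_eq_mul_inv, mul_inv]
    ring
  rw [hc, add_sub_assoc, sub_eq_add_neg]
  simp only [Finset.smul_sum, smul_smul, ← Finset.sum_neg_distrib, smul_neg]
  rw [← sub_eq_add_neg (t m.succ) (t 0)]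
  congr 1
  refine Eq.trans ?_ (sub_eq_add_neg _ _).symm
  congr 1
  · refine Finset.sum_congr rfl fun r _ => Finset.sum_congr rfl fun k _ => ?_
    rw [mul_assoc, mul_comm (1 / T.mass d σ)]
  · rw [← Finset.sum_neg_distrib]
    refine Finset.sum_congr rfl fun r _ => ?_
    rw [← Finset.sum_neg_distrib]
    refine Finset.sum_congr rfl fun k _ => ?_
    congr 2
    field_simp

end Operators

end KineticRD

namespace KineticRD

/-! ### The algebra of the kinetic defect. -/

section Defect

variable {N : ℕ} {V : Type*} [AddCommGroup V] [Module ℝ V]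

/-- Unprimed letters stand for nodal values, primed ones for cell means, `Q` for advection
residuals. Splitting `F m` with weights `ε / (ε + δ)` and `δ / (ε + δ)` separates an advection
defect from a source defect. -/
theorem kinetic_defect_eq {ε δ : ℝ} (hεδ : ε + δ ≠ 0) (c : Fin (N + 1) → ℝ)
    (hc : ∑ r, c r = δ) (m : Fin (N + 1)) (F G MF MG F' G' MF' MG' QF QG : Fin (N + 1) → V) :
    ((F m - (ε / (ε + δ)) • F 0 + (ε / (ε + δ)) • δ • QF 0 - (δ / (ε + δ)) • MF m) -
        (G m - (ε / (ε + δ)) • G 0 + (ε / (ε + δ)) • δ • QG 0 - (δ / (ε + δ)) • MG m)) -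
      (((ε / (ε + δ)) • (F' m - F' 0 + ∑ r, c r • QF r) -
          (1 / (ε + δ)) • ∑ r, c r • (MF' r - F' r)) -
        ((ε / (ε + δ)) • (G' m - G' 0 + ∑ r, c r • QG r) -
          (1 / (ε + δ)) • ∑ r, c r • (MG' r - G' r))) =
    (ε / (ε + δ)) • (((F m - G m - (F' m - G' m)) - (F 0 - G 0 - (F' 0 - G' 0))) +
        (δ • (QF 0 - QG 0) - ∑ r, c r • (QF r - QG r))) +
      (1 / (ε + δ)) • ∑ r, c r •
        (((F m - G m) - (F r - G r)) + (F r - G r - (F' r - G' r)) -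
          (((MF m - MG m) - (MF r - MG r)) + (MF r - MG r - (MF' r - MG' r)))) := by
  have hy : ∑ r, c r • (((F m - G m) - (F r - G r)) + (F r - G r - (F' r - G' r)) -
      (((MF m - MG m) - (MF r - MG r)) + (MF r - MG r - (MF' r - MG' r)))) =
      δ • (F m - G m - (MF m - MG m)) - ∑ r, c r • (F' r - G' r - (MF' r - MG' r)) := by
    -- Writing `δ` as `∑ r, c r` spreads the implicit source at substep `m` over all quadrature
    -- nodes, so only differences remain.
    rw [← hc, Finset.sum_smul, ← Finset.sum_sub_distrib]
    refine Finset.sum_congr rfl fun r _ => ?_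
    module
  rw [hy]
  simp only [smul_sub, Finset.sum_sub_distrib]
  match_scalars <;> field_simp
  ring

end Defect

/-! ### First order bounds on a single substep. -/

section Bounds

variable {D L K d N : ℕ} {Λ : Fin D → Fin L → ℝ} {P : Eu L →L[ℝ] Eu K}
  {Mx : Eu K → Eu L} {t τ : Fin (N + 1) → ℝ} {T : Mesh D} {φ : AdvectionResidual Λ T d}
  {f g : Fin (N + 1) → T.FE d (Eu L)} {C₁ C₂ C₃ S η B : ℝ}

/-- This is the square root of the residual hypothesis; `C₃` needs no sign, since `Real.sqrt_mul'`
only asks for `0 ≤ x ^ 2`. -/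
theorem norm_nodalMean_sub_le {W : Type} [NormedAddCommGroup W] [NormedSpace ℝ W] {x : ℝ}
    {r s : Fin T.n → T.dofs d → W} (hx : 0 ≤ x)
    (h : ∑ σ, 1 / T.mass d σ * ‖∑ k ∈ T.cellsOf d σ, (r k σ - s k σ)‖ ^ 2 ≤ C₃ * x ^ 2) :
    T.norm (T.nodalMean r - T.nodalMean s) ≤ √C₃ * x := by
  rw [← T.nodalMean_sub, ← Real.sqrt_sq (T.norm_nonneg _), T.norm_nodalMean_sq,
    ← Real.sqrt_sq hx, ← Real.sqrt_mul' _ (sq_nonneg _)]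
  exact Real.sqrt_le_sqrt h

theorem norm_comp_sub_le {ℓ : ℝ≥0} (hM : LipschitzWith ℓ Mx) (a b : T.FE d (Eu L)) :
    T.norm (fun σ => Mx (P (a σ)) - Mx (P (b σ))) ≤ ℓ * ‖P‖ * T.norm (a - b) := by
  have h0 : 0 ≤ ℓ * ‖P‖ := by positivity
  rw [← abs_of_nonneg h0, ← T.norm_smul]
  refine T.norm_le_norm fun σ _ => ?_
  rw [Pi.smul_apply, norm_smul, Real.norm_of_nonneg h0, mul_assoc]
  refine (hM.norm_sub_le _ _).trans (mul_le_mul_of_nonneg_left ?_ ℓ.2)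
  rw [← map_sub]
  exact P.le_opNorm _

theorem tripleNorm_comp_sub_le {ℓ : ℝ≥0} (hM : LipschitzWith ℓ Mx) :
    T.tripleNorm (fun m σ => Mx (P (f m σ)) - Mx (P (g m σ))) ≤
      ℓ * ‖P‖ * T.tripleNorm (fun m => f m - g m) := by
  have h0 : 0 ≤ ℓ * ‖P‖ := by positivity
  rw [← abs_of_nonneg h0, Mesh.tripleNorm, Mesh.tripleNorm, ← T.stepNorm_smul]
  refine T.stepNorm_mono fun m => ?_
  rw [T.norm_smul, abs_of_nonneg h0]
  exact norm_comp_sub_le hM _ _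

/-- The difference of the two operators for `u = P f` is of first order. -/
theorem norm_macroscopic_defect_le (hD : 1 ≤ D) (hN : 0 < N) (hC₁ : 0 ≤ C₁) (hC₂ : 0 ≤ C₂)
    (ht : StrictMono t) (hS : t (Fin.last N) - t 0 ≤ S) (hη : t (Fin.last N) - t 0 ≤ η)
    (hh : T.h ≤ η) (hB : 0 ≤ B)
    (hc : ∀ m, ∑ r, |quadWeight t m r| ≤ B * (t m - t 0))
    (hs : T.SeminormBounds C₁ C₂ t (fun m σ => P (f m σ) - P (g m σ))
      (fun m k x => P (T.eval (f m) k x) - P (T.eval (g m) k x)))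
    (hr : ∀ m, ResidualLipschitzU P C₃ T φ (f m) (g m)) (m : Fin N) :
    T.norm ((L1u P t T φ f m - L1u P t T φ g m) - (L2u P t T φ f m - L2u P t T φ g m)) ≤
      (2 * C₁ + (1 + B) * √C₃) * (1 + 2 * N * C₂ * S) * η *
        T.tripleNorm (fun m σ => P (f m σ) - P (g m σ)) := by
  have hPc : ∀ (f : Fin (N + 1) → T.FE d (Eu L)) r k, Continuous fun x => P (T.eval (f r) k x) :=
    fun f r k => P.continuous.comp (T.continuous_eval _ k)
  have hS0 : 0 ≤ S := (sub_nonneg.2 (ht.monotone (Fin.zero_le _))).trans hS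
  have hη0 : 0 ≤ η := T.h_nonneg.trans hh
  set X := T.tripleNorm (fun m σ => P (f m σ) - P (g m σ)) with hX
  have hX0 : 0 ≤ X := T.tripleNorm_nonneg _
  have hδ : 0 ≤ t m.succ - t 0 := sub_nonneg.2 (ht.monotone (Fin.zero_le _))
  have hδη : t m.succ - t 0 ≤ η :=
    (sub_le_sub_right (ht.monotone (Fin.le_last _)) _).trans hη
  have hA : ∀ r, T.norm ((fun σ => P (f r σ) - P (g r σ)) -
      (T.cellMean d (fun k x => P (T.eval (f r) k x)) -
        T.cellMean d (fun k x => P (T.eval (g r) k x)))) ≤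
      η * (C₁ * ((1 + 2 * N * C₂ * S) * X)) := fun r => by
    rw [← T.cellMean_sub (hPc f r) (hPc g r)]
    exact T.norm_sub_cellMean_le_of_seminormBounds hD hN hC₁ ht hS hh
      (fun r k => (hPc f r k).sub (hPc g r k)) hs r
  have hq : ∀ r, T.norm (T.nodalMean (fun k σ => P (φ.res k σ (f r))) -
      T.nodalMean (fun k σ => P (φ.res k σ (g r)))) ≤ √C₃ * ((1 + 2 * N * C₂ * S) * X) := fun r =>
    (norm_nodalMean_sub_le (T.norm_nonneg _) (hr r)).trans
      (mul_le_mul_of_nonneg_left (T.norm_le_of_seminormBounds hN ht hS hs r) (Real.sqrt_nonneg _))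
  have key := T.norm_advection_defect_le (by positivity) hδ (hc m.succ) (hA m.succ) (hA 0) hq
  rw [L1u_eq, L1u_eq, L2u_eq, L2u_eq]
  refine le_trans (le_of_eq ?_) (key.trans ?_)
  · congr 1
    have e : ∀ f g : T.FE d (Eu L),
        (fun σ => P (f σ) - P (g σ)) = (fun σ => P (f σ)) - fun σ => P (g σ) := fun _ _ => rfl
    simp only [e, smul_sub, Finset.sum_sub_distrib]
    abel
  · have : (1 + B) * (t m.succ - t 0) * (√C₃ * ((1 + 2 * N * C₂ * S) * X)) ≤
        (1 + B) * η * (√C₃ * ((1 + 2 * N * C₂ * S) * X)) := by gcongr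
    linarith

/-- The difference of the two operators for `f` is of first order, uniformly in `ε`. -/
theorem norm_kinetic_defect_le {ε : ℝ} {ℓ : ℝ≥0} (hM : LipschitzWith ℓ Mx) (hε : 0 < ε)
    (hD : 1 ≤ D) (hN : 0 < N)
    (hC₁ : 0 ≤ C₁) (hC₂ : 0 ≤ C₂)
    (ht : StrictMono t) (hS : t (Fin.last N) - t 0 ≤ S) (hη : t (Fin.last N) - t 0 ≤ η)
    (hh : T.h ≤ η) (hB : 0 ≤ B)
    (hc : ∀ m, ∑ r, |quadWeight t m r| ≤ B * (t m - t 0))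
    (hs : T.SeminormBounds C₁ C₂ t (fun m => f m - g m)
      (fun m k x => T.eval (f m) k x - T.eval (g m) k x))
    (hsM : T.SeminormBounds C₁ C₂ t (fun m σ => Mx (P (f m σ)) - Mx (P (g m σ)))
      (fun m k x => Mx (P (T.eval (f m) k x)) - Mx (P (T.eval (g m) k x))))
    (hr : ∀ m, ResidualLipschitz C₃ T φ (f m) (g m)) (m : Fin N) :
    T.norm ((L1 P Mx ε t T φ f m - L1 P Mx ε t T φ g m) -
        (L2 P Mx ε t T φ f m - L2 P Mx ε t T φ g m)) ≤
      ((2 * C₁ + (1 + B) * √C₃) * (1 + 2 * N * C₂ * S) +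
        B * ((2 * N * C₂ + C₁ * (1 + 2 * N * C₂ * S)) * (1 + ℓ * ‖P‖))) * η *
        T.tripleNorm (fun m => f m - g m) := by
  have hMc : ∀ (f : Fin (N + 1) → T.FE d (Eu L)) r k,
      Continuous fun x => Mx (P (T.eval (f r) k x)) :=
    fun f r k => hM.continuous.comp (P.continuous.comp (T.continuous_eval _ k))
  have hS0 : 0 ≤ S := (sub_nonneg.2 (ht.monotone (Fin.zero_le _))).trans hS
  have hη0 : 0 ≤ η := T.h_nonneg.trans hh
  set X := T.tripleNorm (fun m => f m - g m) with hX
  have hX0 : 0 ≤ X := T.tripleNorm_nonneg _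
  have hXM : T.tripleNorm (fun m σ => Mx (P (f m σ)) - Mx (P (g m σ))) ≤ ℓ * ‖P‖ * X :=
    tripleNorm_comp_sub_le hM
  set δ := t m.succ - t 0 with hδ_def
  have hδ : 0 ≤ δ := sub_nonneg.2 (ht.monotone (Fin.zero_le _))
  have hδη : δ ≤ η := (sub_le_sub_right (ht.monotone (Fin.le_last _)) _).trans hη
  have hA : ∀ r, T.norm (f r - g r - (T.cellMean d (T.eval (f r)) - T.cellMean d (T.eval (g r))))
      ≤ η * (C₁ * ((1 + 2 * N * C₂ * S) * X)) := fun r => by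
    rw [← T.cellMean_sub (T.continuous_eval (f r)) (T.continuous_eval (g r))]
    exact T.norm_sub_cellMean_le_of_seminormBounds hD hN hC₁ ht hS hh
      (fun r k => (T.continuous_eval _ k).sub (T.continuous_eval _ k)) hs r
  have hAM : ∀ r, T.norm ((fun σ => Mx (P (f r σ))) - (fun σ => Mx (P (g r σ))) -
      (T.cellMean d (fun k x => Mx (P (T.eval (f r) k x))) -
        T.cellMean d (fun k x => Mx (P (T.eval (g r) k x))))) ≤
      η * (C₁ * ((1 + 2 * N * C₂ * S) *
        T.tripleNorm (fun m σ => Mx (P (f m σ)) - Mx (P (g m σ))))) := fun r => by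
    rw [← T.cellMean_sub (hMc f r) (hMc g r)]
    exact T.norm_sub_cellMean_le_of_seminormBounds hD hN hC₁ ht hS hh
      (fun r k => (hMc f r k).sub (hMc g r k)) hsM r
  -- Here the interval is bounded by the small `η` rather than by `S`: these differences must supply
  -- a power of `Δ`.
  have hd := T.norm_sub_le_of_seminormBounds ht hη hs
  have hdM : ∀ m r, T.norm (((fun σ => Mx (P (f m σ))) - (fun σ => Mx (P (g m σ)))) -
      ((fun σ => Mx (P (f r σ))) - (fun σ => Mx (P (g r σ))))) ≤
      2 * N * C₂ * η * T.tripleNorm (fun m σ => Mx (P (f m σ)) - Mx (P (g m σ))) :=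
    T.norm_sub_le_of_seminormBounds ht hη hsM
  have hq : ∀ r, T.norm (T.nodalMean (fun k σ => φ.res k σ (f r)) -
      T.nodalMean (fun k σ => φ.res k σ (g r))) ≤ √C₃ * ((1 + 2 * N * C₂ * S) * X) := fun r =>
    (norm_nodalMean_sub_le (T.norm_nonneg _) (hr r)).trans
      (mul_le_mul_of_nonneg_left (T.norm_le_of_seminormBounds hN ht hS hs r) (Real.sqrt_nonneg _))
  have key := T.norm_advection_defect_le (by positivity) hδ (hc m.succ) (hA m.succ) (hA 0) hq
  have hεδ : 0 < ε + δ := by positivity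
  rw [L1_eq, L1_eq, L2_eq (hM := hM.continuous) (hε := hε.ne'),
    L2_eq (hM := hM.continuous) (hε := hε.ne'), ← hδ_def,
    kinetic_defect_eq hεδ.ne' (quadWeight t m.succ) (sum_quadWeight ht.injective m.succ) m.succ
      f g (fun m σ => Mx (P (f m σ))) (fun m σ => Mx (P (g m σ)))
      (fun r => T.cellMean d (T.eval (f r))) (fun r => T.cellMean d (T.eval (g r)))
      (fun r => T.cellMean d (fun k x => Mx (P (T.eval (f r) k x))))
      (fun r => T.cellMean d (fun k x => Mx (P (T.eval (g r) k x))))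
      (fun r => T.nodalMean (fun k σ => φ.res k σ (f r)))
      (fun r => T.nodalMean (fun k σ => φ.res k σ (g r)))]
  have hy : ∀ r, T.norm (((f m.succ - g m.succ) - (f r - g r)) +
      (f r - g r - (T.cellMean d (T.eval (f r)) - T.cellMean d (T.eval (g r)))) -
      ((((fun σ => Mx (P (f m.succ σ))) - (fun σ => Mx (P (g m.succ σ)))) -
          ((fun σ => Mx (P (f r σ))) - (fun σ => Mx (P (g r σ))))) +
        ((fun σ => Mx (P (f r σ))) - (fun σ => Mx (P (g r σ))) -
          (T.cellMean d (fun k x => Mx (P (T.eval (f r) k x))) -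
            T.cellMean d (fun k x => Mx (P (T.eval (g r) k x))))))) ≤
      (2 * N * C₂ + C₁ * (1 + 2 * N * C₂ * S)) * (1 + ℓ * ‖P‖) * η * X := fun r => by
    refine (T.norm_sub_le _ _).trans ((add_le_add ((T.norm_add_le _ _).trans
      (add_le_add (hd m.succ r) (hA r))) ((T.norm_add_le _ _).trans
      (add_le_add (hdM m.succ r) (hAM r)))).trans ?_)
    -- Lipschitz continuity of `Mx` trades the triple norm of the Maxwellian differences for that of
    -- `f - g`.
    have : (2 * N * C₂ + C₁ * (1 + 2 * N * C₂ * S)) * η *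
        T.tripleNorm (fun m σ => Mx (P (f m σ)) - Mx (P (g m σ))) ≤
        (2 * N * C₂ + C₁ * (1 + 2 * N * C₂ * S)) * η * (ℓ * ‖P‖ * X) := by gcongr
    linarith
  have hsum := T.norm_sum_smul_le (by positivity) (hc m.succ) hy
  refine (T.norm_add_le _ _).trans ?_
  rw [T.norm_smul, T.norm_smul, abs_of_nonneg (by positivity), abs_of_nonneg (by positivity)]
  have hθ : ε / (ε + δ) ≤ 1 := (div_le_one hεδ).2 (by linarith)
  have h1 := (mul_le_of_le_one_left (T.norm_nonneg _) hθ).trans key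
  have h2 := mul_le_mul_of_nonneg_left hsum (by positivity : 0 ≤ 1 / (ε + δ))
  -- The `δ` from the weights is spent on the stiff prefactor, making the bound uniform in `ε`; the
  -- factor `η` of the source part comes from `hy`.
  have hψ : 1 / (ε + δ) * δ ≤ 1 := by
    rw [one_div, inv_mul_le_one₀ hεδ]
    linarith
  have h3 : 1 / (ε + δ) * (B * δ * ((2 * N * C₂ + C₁ * (1 + 2 * N * C₂ * S)) * (1 + ℓ * ‖P‖) *
      η * X)) ≤ B * ((2 * N * C₂ + C₁ * (1 + 2 * N * C₂ * S)) * (1 + ℓ * ‖P‖) * η * X) := by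
    have := mul_le_mul_of_nonneg_right hψ (by positivity :
      0 ≤ B * ((2 * N * C₂ + C₁ * (1 + 2 * N * C₂ * S)) * (1 + ℓ * ‖P‖) * η * X))
    linarith
  have h4 : (1 + B) * δ * (√C₃ * ((1 + 2 * N * C₂ * S) * X)) ≤
      (1 + B) * η * (√C₃ * ((1 + 2 * N * C₂ * S) * X)) := by gcongr
  have h5 := add_le_add h1 (h2.trans h3)
  refine h5.trans ?_
  linarith

end Bounds

end KineticRD

/-! ### Choice of the constant. -/

theorem mainTheorem1 {D L K d N : ℕ} (hD : 1 ≤ D) (hd : 1 ≤ d)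
    (Λ : Fin D → Fin L → ℝ)
    (P : KineticRD.Eu L →L[ℝ] KineticRD.Eu K)
    (Mx : KineticRD.Eu K → KineticRD.Eu L) (ℓ : ℝ≥0) (hM : LipschitzWith ℓ Mx)
    (τ : Fin (N + 1) → ℝ) (hτ : StrictMono τ) (hτ0 : τ 0 = 0) (hτ1 : τ (Fin.last N) = 1)
    (Tmax κ C₁ C₂ C₃ : ℝ) :
    ∃ α₂ : ℝ, 0 < α₂ ∧
      ∀ (T : KineticRD.Mesh D) (φ : KineticRD.AdvectionResidual Λ T d) (tn Δt ε Δ : ℝ),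
        0 < Δt → Δt ≤ Tmax → 0 < ε → 0 < Δ → T.h ≤ κ * Δ → Δt ≤ κ * Δ →
        ∀ t : Fin (N + 1) → ℝ, (∀ m, t m = tn + τ m * Δt) →
        ∀ f g : Fin (N + 1) → T.FE d (KineticRD.Eu L),
          (T.SeminormBounds C₁ C₂ t (fun m σ => P (f m σ) - P (g m σ))
              (fun m k x => P (T.eval (f m) k x) - P (T.eval (g m) k x)) →
            (∀ m, KineticRD.ResidualLipschitzU P C₃ T φ (f m) (g m)) →
            T.stepNorm (fun m =>
                (KineticRD.L1u P t T φ f m - KineticRD.L1u P t T φ g m)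
                  - (KineticRD.L2u P t T φ f m - KineticRD.L2u P t T φ g m)) ≤
              α₂ * Δ * T.tripleNorm (fun m σ => P (f m σ) - P (g m σ))) ∧
          (T.SeminormBounds C₁ C₂ t (fun m => f m - g m)
              (fun m k x => T.eval (f m) k x - T.eval (g m) k x) →
            T.SeminormBounds C₁ C₂ t (fun m σ => Mx (P (f m σ)) - Mx (P (g m σ)))
              (fun m k x => Mx (P (T.eval (f m) k x)) - Mx (P (T.eval (g m) k x))) →
            (∀ m, KineticRD.ResidualLipschitz C₃ T φ (f m) (g m)) →
            T.stepNorm (fun m =>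
                (KineticRD.L1 P Mx ε t T φ f m - KineticRD.L1 P Mx ε t T φ g m)
                  - (KineticRD.L2 P Mx ε t T φ f m - KineticRD.L2 P Mx ε t T φ g m)) ≤
              α₂ * Δ * T.tripleNorm (fun m => f m - g m)) := by
  have hN : 0 < N := by
    rcases Nat.eq_zero_or_pos N with rfl | h
    · simp [hτ0] at hτ1
    · exact h
  set B := KineticRD.lagrangeBound τ with hB_def
  have hB : 0 ≤ B := KineticRD.lagrangeBound_nonneg τ
  -- The given constants may be negative, so absolute values are used; the hypotheses only weaken.
  set E₁ := (2 * |C₁| + (1 + B) * √C₃) * (1 + 2 * N * |C₂| * |Tmax|) with hE₁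
  set E₂ := B * ((2 * N * |C₂| + |C₁| * (1 + 2 * N * |C₂| * |Tmax|)) * (1 + ℓ * ‖P‖)) with hE₂
  have hE₁0 : 0 ≤ E₁ := by positivity
  have hE₂0 : 0 ≤ E₂ := by positivity
  -- `E₁` suffices for the first claim and `E₁ + E₂` for the second; `N` comes from collecting the
  -- substeps, `|κ|` from `η = |κ| * Δ`, and the `1` ensures positivity.
  refine ⟨N * ((E₁ + E₂) * |κ|) + 1, by positivity, ?_⟩
  intro T φ tn Δt ε Δ hΔt hTmax hε hΔ hh hκ t ht f g
  have htτ : StrictMono t := fun i j hij => by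
    rw [ht, ht]
    have := mul_lt_mul_of_pos_right (hτ hij) hΔt
    linarith
  have hlast : t (Fin.last N) - t 0 = Δt := by rw [ht, ht, hτ0, hτ1]; ring
  have hκΔ : κ * Δ ≤ |κ| * Δ := mul_le_mul_of_nonneg_right (le_abs_self κ) hΔ.le
  have hS : t (Fin.last N) - t 0 ≤ |Tmax| := by linarith [le_abs_self Tmax]
  have hη : t (Fin.last N) - t 0 ≤ |κ| * Δ := by linarith
  have hh' : T.h ≤ |κ| * Δ := hh.trans hκΔ
  have hc := KineticRD.sum_abs_quadWeight_le hΔt ht hτ hτ0 hτ1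
  have hfin : ∀ {E X : ℝ}, 0 ≤ X → E ≤ E₁ + E₂ →
      N * (E * (|κ| * Δ) * X) ≤ (N * ((E₁ + E₂) * |κ|) + 1) * Δ * X := fun {E X} hX hE => by
    calc N * (E * (|κ| * Δ) * X) ≤ N * ((E₁ + E₂) * (|κ| * Δ) * X) := by gcongr
      _ ≤ N * ((E₁ + E₂) * (|κ| * Δ) * X) + Δ * X := le_add_of_nonneg_right (by positivity)
      _ = _ := by ring
  constructor
  · intro hs hr
    refine (T.stepNorm_le (mul_nonneg (by positivity) (T.tripleNorm_nonneg _)) fun m =>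
      KineticRD.norm_macroscopic_defect_le hD hN (abs_nonneg C₁) (abs_nonneg C₂) htτ hS hη hh' hB
        hc (hs.mono (le_abs_self C₁) (le_abs_self C₂)) hr m).trans ?_
    exact hfin (T.tripleNorm_nonneg _) (by linarith)
  · intro hs hsM hr
    refine (T.stepNorm_le (mul_nonneg (by positivity) (T.tripleNorm_nonneg _)) fun m =>
      KineticRD.norm_kinetic_defect_le hM hε hD hN (abs_nonneg C₁) (abs_nonneg C₂) htτ hS hη hh'
        hB hc (hs.mono (le_abs_self C₁) (le_abs_self C₂))
        (hsM.mono (le_abs_self C₁) (le_abs_self C₂)) hr m).trans ?_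
    exact hfin (T.tripleNorm_nonneg _) le_rfl
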